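/- **Setting.** Let $d\le n$ and let $M\subset\mathbb R^n$ be an embedded $C^3$ submanifold of dimension $d$, $x\in M$. Let $\iota$ be a $C^3$ local parametrization of $M$ near $x$, defined near $0\in\mathbb R^d$, with $\iota(0)=x$ and such that $\boldsymbol\tau_i=\partial\iota(0)/\partial\rho_i$, $i=1,\dots,d$, are orthonormal (for instance geodesic normal coordinates of a smooth $M$, or the coordinates given by orthogonal projection to $T_xM$). Let $\mathbf P=D\iota(D\iota^\top D\iota)^{-1}D\iota^\top$, evaluated at $0$, be the orthogonal projection matrix onto $T_xM$. Fix $K>\tfrac12 d(d+1)$. For $\epsilon>0$ let $\boldsymbol\rho^{(1)},\dots,\boldsymbol\rho^{(K)}$ be i.i.d. uniform on $[-\sqrt\epsilon,\sqrt\epsilon]^d$ and let $y_\ell=\iota(\boldsymbol\rho^{(\ell)})\in M$ be the neighbours of $x$. **Matrices and estimator.** Let $\mathbf D=[y_1-x,\dots,y_K-x]\in\mathbb R^{n\times K}$. Let $\mathbf R\in\mathbb R^{K\times n}$ have rows $\sum_i\rho^{(\ell)}_i\boldsymbol\tau_i^\top$, and let $\mathbf A\in\mathbb R^{K\times d(d+1)/2}$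 have as its $\ell$-th row the numbers $(\rho^{(\ell)}_i)^2$ $(1\le i\le d)$ and $2\rho^{(\ell)}_i\rho^{(\ell)}_j$ $(i<j)$. Let $\tilde{\mathbf T}=[\tilde{\boldsymbol t}_1,\dots,\tilde{\boldsymbol t}_d]$ consist of leading $d$ left singular vectors of $\mathbf D$ (any choice), let $\tilde\rho^{(\ell)}_j=(y_\ell-x)^\top\tilde{\boldsymbol t}_j$, and let $\tilde{\mathbf A}$ be the matrix $\mathbf A$ with $\tilde\rho$ in place of $\rho$. Put $\tilde{\mathbf Y}=2(\tilde{\mathbf A}^\top\tilde{\mathbf A})^{-1}\tilde{\mathbf A}^\top\mathbf D^\top$, $2\tilde{\mathbf R}^\top=2\mathbf D-(\tilde{\mathbf A}\tilde{\mathbf Y})^\top$ and $\mathbf B=\mathbf I_K-\tilde{\mathbf A}(\tilde{\mathbf A}^\top\tilde{\mathbf A})^{-1}\tilde{\mathbf A}^\top$. The second-order estimator is $\hat{\mathbf P}=\hat{\boldsymbol\Psi}\hat{\boldsymbol\Psi}^\top$, where the columns of $\hat{\boldsymbol\Psi}$ are leading $d$ left singular vectors of $\tilde{\mathbf R}^\top$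 (any choice). **Conditions.** Fix $c>0$ and a function $h$ with $h(\epsilon)=\omega(\epsilon^{3/2})$, i.e. $h(\epsilon)/\epsilon^{3/2}\to+\infty$ as $\epsilon\to0^+$. Consider the conditions on the sample: (i) $\|\mathbf A\|_2/\kappa_2(\mathbf A)\ge K\,h(\epsilon)$, where $\kappa_2$ is the spectral condition number (the left side being $0$ if the columns of $\mathbf A$ are linearly dependent); (ii) the eigenvalues $\lambda_1\ge\dots\ge\lambda_n$ of $\mathbf R^\top\mathbf B^\top\mathbf B\mathbf R$ satisfy $\min_{j\ne i}|\lambda_i-\lambda_j|>c\,\epsilon$ for $i=1,\dots,d$. **Theorem.** There are constants $C,\epsilon_0>0$, depending only on $n,d,K,M,x,\iota,c,h$, such that for all $0<\epsilon<\epsilon_0$: almost surely, whenever the sample satisfies (i) and (ii), $$\|\hat{\mathbf P}-\mathbf P\|_F\le C\epsilon .$$ In particular, for every $\delta\ge0$, if (i) and (ii) hold with probability at least $1-\delta$, then $\|\hat{\mathbf P}-\mathbf P\|_F\le C\epsilon$ with probability at least $1-\delta$. -/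

import Mathlib

open MeasureTheory ProbabilityTheory Filter Topology
open scoped ENNReal

namespace LocalSVD

noncomputable section

/-! ### Embedded manifolds, local parametrizations, the tangential projection matrix -/

/-- `ι` is a `C³` local parametrization, based at `x = ι 0`, of the `d`-dimensional set
`M ⊆ ℝⁿ`: on some open `O ∋ 0` it is a `C³` immersion and a homeomorphism onto a relatively open
subset of `M`. -/
def IsLocalParametrization {n d : ℕ} (M : Set (EuclideanSpace ℝ (Fin n)))
    (x : EuclideanSpace ℝ (Fin n))
    (ι : EuclideanSpace ℝ (Fin d) → EuclideanSpace ℝ (Fin n)) : Prop :=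
  ι 0 = x ∧
  ∃ O : Set (EuclideanSpace ℝ (Fin d)), IsOpen O ∧ 0 ∈ O ∧
    ContDiffOn ℝ 3 ι O ∧
    (∀ u ∈ O, Function.Injective (fderiv ℝ ι u)) ∧
    Set.InjOn ι O ∧
    ∀ V ⊆ O, IsOpen V → ∃ U : Set (EuclideanSpace ℝ (Fin n)), IsOpen U ∧ ι '' V = M ∩ U

/-- `M` is a `d`-dimensional embedded `C³` submanifold of `ℝⁿ`. -/
def IsEmbeddedManifold {n : ℕ} (d : ℕ) (M : Set (EuclideanSpace ℝ (Fin n))) : Prop :=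
  ∀ p ∈ M, ∃ ι : EuclideanSpace ℝ (Fin d) → EuclideanSpace ℝ (Fin n),
    IsLocalParametrization M p ι

/-- The `n × d` Jacobian of `ι` at the origin; its `j`-th column is `τ_j = ∂ι(0)/∂ρ_j`. -/
def jacobian {n d : ℕ} (ι : EuclideanSpace ℝ (Fin d) → EuclideanSpace ℝ (Fin n)) :
    Matrix (Fin n) (Fin d) ℝ :=
  Matrix.of fun s j => fderiv ℝ ι 0 (EuclideanSpace.single j 1) s

/-- The tangential projection matrix `P = Dι (Dιᵀ Dι)⁻¹ Dιᵀ` at the base point `ι 0`. -/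
def tangentProjection {n d : ℕ} (ι : EuclideanSpace ℝ (Fin d) → EuclideanSpace ℝ (Fin n)) :
    Matrix (Fin n) (Fin n) ℝ :=
  jacobian ι * ((jacobian ι).transpose * jacobian ι)⁻¹ * (jacobian ι).transpose

/-! ### Matrix norms, condition number, singular vectors, eigenvalues -/

/-- Frobenius norm. -/
def frobeniusNorm {n m : ℕ} (S : Matrix (Fin n) (Fin m) ℝ) : ℝ :=
  Real.sqrt (∑ i, ∑ j, S i j ^ 2)

/-- Spectral norm: the largest singular value. -/
def spectralNorm {m q : Type} [Fintype m] [Fintype q] [DecidableEq q] (S : Matrix m q ℝ) : ℝ :=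
  ‖(Matrix.toEuclideanLin S).toContinuousLinearMap‖

/-- The smallest of the singular values attached to the columns, `min_{‖v‖ = 1} ‖S v‖`. -/
def minSingularValue {m q : Type} [Fintype m] [Fintype q] [DecidableEq q] (S : Matrix m q ℝ) : ℝ :=
  ⨅ v : Metric.sphere (0 : EuclideanSpace ℝ q) 1, ‖Matrix.toEuclideanLin S v‖

/-- The condition number `κ₂(S) = σ_max(S) / σ_min(S)`. When the columns of `S` are linearly
dependent this is `0` instead of `∞`; then `spectralNorm S / conditionNumber S = 0`, which is also
the value given by the convention `κ₂(S) = ∞`. -/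
def conditionNumber {m q : Type} [Fintype m] [Fintype q] [DecidableEq q] (S : Matrix m q ℝ) : ℝ :=
  spectralNorm S / minSingularValue S

/-- The columns of `Ψ` are leading `d` left singular vectors of `S`: there is a singular value
decomposition `S = U Σ Vᵀ` with `U`, `V` orthogonal and nonincreasing singular values such that
`Ψ` consists of the first `d` columns of `U`. -/
def IsLeadingLeftSingularVectors {n d K : ℕ} (hdn : d ≤ n) (S : Matrix (Fin n) (Fin K) ℝ)
    (Ψ : Matrix (Fin n) (Fin d) ℝ) : Prop :=
  ∃ U ∈ Matrix.orthogonalGroup (Fin n) ℝ, ∃ V ∈ Matrix.orthogonalGroup (Fin K) ℝ,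
    ∃ σ : Fin n → ℝ, Antitone σ ∧ (∀ i, 0 ≤ σ i) ∧
      S = U * (Matrix.of fun (i : Fin n) (j : Fin K) => if (i : ℕ) = j then σ i else 0)
            * V.transpose ∧
      Ψ = Matrix.of fun s j => U s (Fin.castLE hdn j)

theorem isHermitian_gram {n K : ℕ} (R : Matrix (Fin K) (Fin n) ℝ) (B : Matrix (Fin K) (Fin K) ℝ) :
    (R.transpose * B.transpose * B * R).IsHermitian := by
  have h := Matrix.isHermitian_conjTranspose_mul_self (B * R)
  simpa [Matrix.conjTranspose_eq_transpose_of_trivial, Matrix.transpose_mul, Matrix.mul_assoc]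
    using h

/-- The `i`-th eigenvalue (with multiplicity, in nonincreasing order) of `Rᵀ Bᵀ B R`. -/
def gramEigenvalue {n K : ℕ} (R : Matrix (Fin K) (Fin n) ℝ) (B : Matrix (Fin K) (Fin K) ℝ)
    (i : Fin n) : ℝ :=
  (isHermitian_gram R B).eigenvalues₀ (Fin.cast (Fintype.card_fin n).symm i)

/-- The leading `d` eigenvalues `λ₁, …, λ_d` of `Rᵀ Bᵀ B R` satisfy `|λ_i - λ_j| > g` for every
other eigenvalue `λ_j`, `1 ≤ j ≤ n`, `j ≠ i` (so that they are simple when `g ≥ 0`). -/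
def HasSpectralGap {n K : ℕ} (d : ℕ) (R : Matrix (Fin K) (Fin n) ℝ)
    (B : Matrix (Fin K) (Fin K) ℝ) (g : ℝ) : Prop :=
  ∀ i j : Fin n, (i : ℕ) < d → j ≠ i → g < |gramEigenvalue R B i - gramEigenvalue R B j|

/-! ### The second-order local SVD estimator -/

/-- The difference matrix `D`, with columns `D_i = y_i - x`. -/
def differenceMatrix {n K : ℕ} (x : EuclideanSpace ℝ (Fin n))
    (y : Fin K → EuclideanSpace ℝ (Fin n)) : Matrix (Fin n) (Fin K) ℝ :=
  Matrix.of fun s i => y i s - x s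

/-- Pairs `(i, j)` with `i ≤ j`; there are `d (d + 1) / 2` of them. -/
abbrev QuadIndex (d : ℕ) : Type := {p : Fin d × Fin d // p.1 ≤ p.2}

/-- The quadratic design matrix: the row of the point with coordinates `ρ_1, …, ρ_d` has the
entries `ρ_i²` and `2 ρ_i ρ_j`, `i < j`. -/
def designMatrix {K d : ℕ} (ρ : Matrix (Fin K) (Fin d) ℝ) : Matrix (Fin K) (QuadIndex d) ℝ :=
  Matrix.of fun l p =>
    if p.1.1 = p.1.2 then ρ l p.1.1 ^ 2 else 2 * (ρ l p.1.1 * ρ l p.1.2)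

/-- The design matrix `Ã` of the estimated coordinates `ρ̃_j⁽ⁱ⁾ = D_iᵀ t̃_j`. -/
def estimatedDesign {n d K : ℕ} (Dm : Matrix (Fin n) (Fin K) ℝ) (T : Matrix (Fin n) (Fin d) ℝ) :
    Matrix (Fin K) (QuadIndex d) ℝ :=
  designMatrix (Dm.transpose * T)

/-- The regression solution `Ỹ = 2 (Ãᵀ Ã)⁻¹ Ãᵀ Dᵀ` of `Ã Y = 2 Dᵀ`. -/
def estimatedHessian {n d K : ℕ} (Dm : Matrix (Fin n) (Fin K) ℝ) (T : Matrix (Fin n) (Fin d) ℝ) :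
    Matrix (QuadIndex d) (Fin n) ℝ :=
  (2 : ℝ) • (((estimatedDesign Dm T).transpose * estimatedDesign Dm T)⁻¹
    * (estimatedDesign Dm T).transpose * Dm.transpose)

/-- `2 R̃ᵀ = 2 D - (Ã Ỹ)ᵀ`, an `n × K` matrix. -/
def twoResidual {n d K : ℕ} (Dm : Matrix (Fin n) (Fin K) ℝ) (T : Matrix (Fin n) (Fin d) ℝ) :
    Matrix (Fin n) (Fin K) ℝ :=
  (2 : ℝ) • Dm - (estimatedDesign Dm T * estimatedHessian Dm T).transpose

/-- `B = I - Ã (Ãᵀ Ã)⁻¹ Ãᵀ`. -/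
def residualProjection {n d K : ℕ} (Dm : Matrix (Fin n) (Fin K) ℝ)
    (T : Matrix (Fin n) (Fin d) ℝ) : Matrix (Fin K) (Fin K) ℝ :=
  1 - estimatedDesign Dm T * ((estimatedDesign Dm T).transpose * estimatedDesign Dm T)⁻¹
    * (estimatedDesign Dm T).transpose

/-- A possible outcome `(T̃, Ψ̂)` of the second-order local SVD algorithm on the difference
matrix `D`: `T̃` holds leading `d` left singular vectors of `D` and `Ψ̂` leading `d` left singular
vectors of `2 R̃ᵀ`. The estimator is then `P̂ = Ψ̂ Ψ̂ᵀ`. -/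
def IsSecondOrderSVD {n d K : ℕ} (hdn : d ≤ n) (Dm : Matrix (Fin n) (Fin K) ℝ)
    (T Ψ : Matrix (Fin n) (Fin d) ℝ) : Prop :=
  IsLeadingLeftSingularVectors hdn Dm T ∧ IsLeadingLeftSingularVectors hdn (twoResidual Dm T) Ψ

/-! ### Random neighbours -/

/-- The matrix whose rows are the coordinate vectors `ρ⁽¹⁾, …, ρ⁽ᴷ⁾`. -/
def coordMatrix {K d : ℕ} (ρ : Fin K → EuclideanSpace ℝ (Fin d)) : Matrix (Fin K) (Fin d) ℝ :=
  Matrix.of fun l j => ρ l j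

/-- The matrix `R` with rows `r_l = ∑ i, ρ_i⁽ˡ⁾ τ_i`. -/
def tangentialResidual {n d K : ℕ} (ι : EuclideanSpace ℝ (Fin d) → EuclideanSpace ℝ (Fin n))
    (ρ : Fin K → EuclideanSpace ℝ (Fin d)) : Matrix (Fin K) (Fin n) ℝ :=
  Matrix.of fun l s => ∑ i, ρ l i * jacobian ι s i

/-- The cube `[-√ε, √ε]^d`. -/
def cube (d : ℕ) (ε : ℝ) : Set (EuclideanSpace ℝ (Fin d)) :=
  {v | ∀ j, v j ∈ Set.Icc (-Real.sqrt ε) (Real.sqrt ε)}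

/-- The difference matrix of the neighbours `y_i = ι(ρ⁽ⁱ⁾)` of `x = ι(0)`. -/
def neighbourDifferences {n d K : ℕ} (ι : EuclideanSpace ℝ (Fin d) → EuclideanSpace ℝ (Fin n))
    (ρ : Fin K → EuclideanSpace ℝ (Fin d)) : Matrix (Fin n) (Fin K) ℝ :=
  differenceMatrix (ι 0) fun i => ι (ρ i)

/-- The two conditions on the sample: `‖A‖₂ / κ₂(A) ≥ K a`, and the leading `d` eigenvalues of
`Rᵀ Bᵀ B R` have spectral gaps larger than `g`. -/
def SampleConditions {n d K : ℕ} (ι : EuclideanSpace ℝ (Fin d) → EuclideanSpace ℝ (Fin n))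
    (ρ : Fin K → EuclideanSpace ℝ (Fin d)) (T : Matrix (Fin n) (Fin d) ℝ) (a g : ℝ) : Prop :=
  (K : ℝ) * a ≤ spectralNorm (designMatrix (coordMatrix ρ))
      / conditionNumber (designMatrix (coordMatrix ρ)) ∧
  HasSpectralGap d (tangentialResidual ι ρ)
    (residualProjection (neighbourDifferences ι ρ) T) g

end

end LocalSVD

/-! Write `J = jacobian ι`, `C = coordMatrix ρ`, `A = designMatrix C` and `s = √ε`. Taylor expansion
gives `Dᵀ = C Jᵀ + A Y + E` with `A Y = O(s²)` and `E = O(s³)`. The curvature term `A Y` limits the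
plain SVD to accuracy `O(s)`; regressing on the estimated design `Ã` must remove it up to `O(s³)`.

The spectral gap gives `√c s |v| ≤ |B C v| ≤ |C v|` (`HasSpectralGap.le_gram`), because `B` is a
contraction. A `sin θ` bound (`IsLeadingLeftSingularVectors.mul_norm_compl_le`) then puts the span
of `T` within `O(s)` of the tangent space. Hence the estimated coordinates, rotated by `Tᵀ J`, equal
`C` up to `O(s²)`. Since a linear change of coordinates acts linearly on quadratic monomials, `A = Ã
S + O(s³)`.

Condition (i) makes the least singular value of `A` larger than this `O(s³)` error, so `Ã` has
independent columns and `B Ã = 0`. Therefore `B A = O(s³)` and `B Dᵀ = B C Jᵀ + O(s³)`. A second use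
of the `sin θ` bound, with signal at least `√c s`, leaves an error `O(s³)/s = O(ε)`. All of this is
deterministic; the sampling law only confines the points to the cube. -/

namespace LocalSVD

/-! ### Frobenius norms, projections and a `sin θ` bound for singular subspaces. -/

section FrobeniusNorm

open scoped Matrix Matrix.Norms.Frobenius

theorem frobenius_norm_sq {m q : Type*} [Fintype m] [Fintype q] (S : Matrix m q ℝ) :
    ‖S‖ ^ 2 = ∑ i, ∑ j, S i j ^ 2 := by
  rw [Matrix.frobenius_norm_def, ← Real.sqrt_eq_rpow, Real.sq_sqrt]
  · simp
  · positivity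

theorem frobeniusNorm_eq_norm {n m : ℕ} (S : Matrix (Fin n) (Fin m) ℝ) :
    frobeniusNorm S = ‖S‖ := by
  rw [frobeniusNorm, ← frobenius_norm_sq, Real.sqrt_sq (norm_nonneg _)]

theorem frobenius_norm_sq_eq_trace {m q : Type*} [Fintype m] [Fintype q] (S : Matrix m q ℝ) :
    ‖S‖ ^ 2 = (Sᵀ * S).trace := by
  rw [frobenius_norm_sq, Finset.sum_comm]
  simp [Matrix.trace, Matrix.mul_apply, sq]

theorem frobenius_norm_sq_eq_trace' {m q : Type*} [Fintype m] [Fintype q] (S : Matrix m q ℝ) :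
    ‖S‖ ^ 2 = (S * Sᵀ).trace := by
  rw [frobenius_norm_sq]
  simp [Matrix.trace, Matrix.mul_apply, sq]

theorem frobenius_norm_le_of_abs_le {m q : Type*} [Fintype m] [Fintype q] {S : Matrix m q ℝ}
    {b : ℝ} (hb : 0 ≤ b) (h : ∀ i j, |S i j| ≤ b) :
    ‖S‖ ≤ (Fintype.card m * Fintype.card q) * b := by
  have h1 : ‖S‖ ≤ Real.sqrt ((Fintype.card m * Fintype.card q) * b ^ 2) := by
    rw [← Real.sqrt_sq (norm_nonneg S), frobenius_norm_sq]
    apply Real.sqrt_le_sqrt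
    calc ∑ i, ∑ j, S i j ^ 2 ≤ ∑ _i : m, ∑ _j : q, b ^ 2 := by
          refine Finset.sum_le_sum fun i _ => Finset.sum_le_sum fun j _ => ?_
          exact sq_le_sq' (abs_le.1 (h i j)).1 (abs_le.1 (h i j)).2
      _ = _ := by simp [mul_assoc]
  refine h1.trans (Real.sqrt_le_iff.2 ⟨by positivity, ?_⟩)
  rw [mul_pow]
  gcongr
  rw [sq]
  exact_mod_cast Nat.le_mul_self _

theorem abs_entry_le_frobenius_norm {m q : Type*} [Fintype m] [Fintype q] (S : Matrix m q ℝ)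
    (i : m) (j : q) : |S i j| ≤ ‖S‖ := by
  apply abs_le_of_sq_le_sq _ (norm_nonneg _)
  rw [frobenius_norm_sq]
  calc S i j ^ 2 ≤ ∑ j, S i j ^ 2 :=
        Finset.single_le_sum (f := fun j => S i j ^ 2) (fun _ _ => sq_nonneg _) (Finset.mem_univ j)
    _ ≤ _ := Finset.single_le_sum (f := fun i => ∑ j, S i j ^ 2)
        (fun _ _ => Finset.sum_nonneg fun _ _ => sq_nonneg _) (Finset.mem_univ i)

/-- Pythagoras for an orthogonal projection `Q`. -/
theorem frobenius_norm_sq_compl_projection {m q : Type*} [Fintype m] [Fintype q] [DecidableEq m]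
    {Q : Matrix m m ℝ} (hQ : Qᵀ = Q) (hQ2 : Q * Q = Q) (S : Matrix m q ℝ) :
    ‖(1 - Q) * S‖ ^ 2 = ‖S‖ ^ 2 - ‖Q * S‖ ^ 2 := by
  simp only [frobenius_norm_sq_eq_trace, ← Matrix.trace_sub]
  congr 1
  rw [Matrix.transpose_mul, Matrix.transpose_mul, Matrix.transpose_sub, hQ, Matrix.transpose_one,
    Matrix.mul_assoc, Matrix.mul_assoc, ← Matrix.mul_assoc (1 - Q), ← Matrix.mul_assoc Q,
    show (1 - Q) * (1 - Q) = 1 - Q by simp [mul_sub, sub_mul, hQ2], hQ2]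
  simp [Matrix.sub_mul, Matrix.mul_sub]

theorem frobenius_norm_projection_mul_le {m q : Type*} [Fintype m] [Fintype q] [DecidableEq m]
    {Q : Matrix m m ℝ} (hQ : Qᵀ = Q) (hQ2 : Q * Q = Q) (S : Matrix m q ℝ) :
    ‖Q * S‖ ≤ ‖S‖ := by
  apply le_of_sq_le_sq _ (norm_nonneg _)
  have := frobenius_norm_sq_compl_projection hQ hQ2 S
  nlinarith [sq_nonneg ‖(1 - Q) * S‖]

theorem frobenius_norm_compl_projection_mul_le {m q : Type*} [Fintype m] [Fintype q]
    [DecidableEq m] {Q : Matrix m m ℝ} (hQ : Qᵀ = Q) (hQ2 : Q * Q = Q) (S : Matrix m q ℝ) :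
    ‖(1 - Q) * S‖ ≤ ‖S‖ := by
  apply le_of_sq_le_sq _ (norm_nonneg _)
  have := frobenius_norm_sq_compl_projection hQ hQ2 S
  nlinarith [sq_nonneg ‖Q * S‖]

theorem transpose_mul_transpose_self {m q : Type*} [Fintype q] (Q : Matrix m q ℝ) :
    (Q * Qᵀ)ᵀ = Q * Qᵀ := by simp

theorem mul_transpose_idempotent {m q : Type*} [Fintype m] [Fintype q] [DecidableEq q]
    {Q : Matrix m q ℝ} (hQ : Qᵀ * Q = 1) : Q * Qᵀ * (Q * Qᵀ) = Q * Qᵀ := by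
  rw [Matrix.mul_assoc, ← Matrix.mul_assoc Qᵀ, hQ, Matrix.one_mul]

theorem frobenius_norm_isometry_mul {m q r : Type*} [Fintype m] [Fintype q] [Fintype r]
    [DecidableEq q] {Q : Matrix m q ℝ} (hQ : Qᵀ * Q = 1) (S : Matrix q r ℝ) :
    ‖Q * S‖ = ‖S‖ := by
  rw [← sq_eq_sq₀ (norm_nonneg _) (norm_nonneg _), frobenius_norm_sq_eq_trace,
    frobenius_norm_sq_eq_trace, Matrix.transpose_mul, Matrix.mul_assoc, ← Matrix.mul_assoc Qᵀ, hQ,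
    Matrix.one_mul]

theorem frobenius_norm_transpose_isometry_mul_le {m q r : Type*} [Fintype m] [Fintype q]
    [Fintype r] [DecidableEq m] [DecidableEq q] {Q : Matrix m q ℝ} (hQ : Qᵀ * Q = 1)
    (S : Matrix m r ℝ) : ‖Qᵀ * S‖ ≤ ‖S‖ := by
  rw [← frobenius_norm_isometry_mul hQ, ← Matrix.mul_assoc]
  exact frobenius_norm_projection_mul_le (transpose_mul_transpose_self Q)
    (mul_transpose_idempotent hQ) S

theorem frobenius_norm_mul_isometry_le {m q r : Type*} [Fintype m] [Fintype q]
    [Fintype r] [DecidableEq m] [DecidableEq q] {Q : Matrix m q ℝ} (hQ : Qᵀ * Q = 1)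
    (S : Matrix r m ℝ) : ‖S * Q‖ ≤ ‖S‖ := by
  rw [← Matrix.frobenius_norm_transpose, Matrix.transpose_mul, ← Matrix.frobenius_norm_transpose S]
  exact frobenius_norm_transpose_isometry_mul_le hQ _

/-- If `L` is bounded below by `s` acting on row vectors, so is its action on matrices. -/
theorem mul_frobenius_norm_le_of_vecMul {m q r : Type*} [Fintype m] [Fintype q] [Fintype r]
    {L : Matrix q r ℝ} {s : ℝ}
    (hL : ∀ v : q → ℝ, s ^ 2 * (v ⬝ᵥ v) ≤ (v ᵥ* L) ⬝ᵥ (v ᵥ* L)) (X : Matrix m q ℝ) :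
    s * ‖X‖ ≤ ‖X * L‖ := by
  apply le_of_sq_le_sq _ (norm_nonneg _)
  rw [mul_pow, frobenius_norm_sq, frobenius_norm_sq, Finset.mul_sum]
  refine Finset.sum_le_sum fun i _ => ?_
  have h := hL (X i)
  simpa [dotProduct, Matrix.vecMul, Matrix.mul_apply, sq] using h

/-- The difference of the projections onto two `d`-dimensional subspaces. -/
theorem frobenius_norm_sq_projection_sub {m q : Type*} [Fintype m] [Fintype q]
    [DecidableEq m] [DecidableEq q] {P Q : Matrix m q ℝ} (hP : Pᵀ * P = 1) (hQ : Qᵀ * Q = 1) :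
    ‖P * Pᵀ - Q * Qᵀ‖ ^ 2 = 2 * ‖(1 - P * Pᵀ) * Q‖ ^ 2 := by
  have hP1 : (P * Pᵀ).trace = Fintype.card q := by rw [Matrix.trace_mul_comm, hP]; simp
  have hQ1 : (Q * Qᵀ).trace = Fintype.card q := by rw [Matrix.trace_mul_comm, hQ]; simp
  rw [frobenius_norm_sq_compl_projection (transpose_mul_transpose_self P)
    (mul_transpose_idempotent hP), Matrix.mul_assoc P, frobenius_norm_isometry_mul hP,
    frobenius_norm_sq_eq_trace, frobenius_norm_sq_eq_trace, frobenius_norm_sq_eq_trace,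
    Matrix.transpose_sub, transpose_mul_transpose_self, transpose_mul_transpose_self,
    Matrix.sub_mul, Matrix.mul_sub, Matrix.mul_sub, mul_transpose_idempotent hP,
    mul_transpose_idempotent hQ, hQ]
  -- Both cross terms equal `‖Pᵀ Q‖²`, so each side becomes `2 d - 2 ‖Pᵀ Q‖²`, where `d` is the
  -- common rank.
  have h1 : (P * Pᵀ * (Q * Qᵀ)).trace = ((Pᵀ * Q)ᵀ * (Pᵀ * Q)).trace := by
    rw [Matrix.transpose_mul, Matrix.transpose_transpose, ← Matrix.mul_assoc, Matrix.trace_mul_comm]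
    simp only [Matrix.mul_assoc]
  have h2 : (Q * Qᵀ * (P * Pᵀ)).trace = ((Pᵀ * Q)ᵀ * (Pᵀ * Q)).trace := by
    rw [Matrix.trace_mul_comm, h1]
  simp only [Matrix.trace_sub, h1, h2, hP1, hQ1, Matrix.trace_one]
  ring

/-- `∑ δᵢ pᵢ` over weights `0 ≤ pᵢ ≤ 1` of total mass `d` is largest when the mass sits on the
first `d` entries of the nonincreasing sequence `δ`. -/
theorem sum_mul_le_sum_leading {n d : ℕ} {δ p : Fin n → ℝ} (hδ : Antitone δ)
    (hp0 : ∀ i, 0 ≤ p i) (hp1 : ∀ i, p i ≤ 1)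
    (hsum : ∑ i, p i = ∑ i : Fin n, if (i : ℕ) < d then (1 : ℝ) else 0) :
    ∑ i, δ i * p i ≤ ∑ i : Fin n, δ i * if (i : ℕ) < d then (1 : ℝ) else 0 := by
  by_cases hd : d < n
  -- Subtracting the pivot `δ_d` costs nothing because the total masses agree; each remaining term
  -- then has a sign.
  · have h : 0 ≤ ∑ i : Fin n, (δ i - δ ⟨d, hd⟩) * ((if (i : ℕ) < d then (1 : ℝ) else 0) - p i) := by
      refine Finset.sum_nonneg fun i _ => ?_
      split_ifs with hi
      · exact mul_nonneg (sub_nonneg.2 (hδ (Fin.le_def.2 hi.le))) (sub_nonneg.2 (hp1 i))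
      · have h1 : δ i ≤ δ ⟨d, hd⟩ := hδ (Fin.le_def.2 (not_lt.1 hi))
        nlinarith [hp0 i]
    simp only [sub_mul, mul_sub, Finset.sum_sub_distrib, ← Finset.mul_sum] at h
    rw [hsum] at h
    linarith
  · have hlt : ∀ i : Fin n, (i : ℕ) < d := fun i => i.2.trans_le (not_lt.1 hd)
    simp only [hlt, if_true] at hsum ⊢
    have h0 : ∑ i, (1 - p i) = 0 := by rw [Finset.sum_sub_distrib, hsum, sub_self]
    have h1 := (Finset.sum_eq_zero_iff_of_nonneg fun i _ => sub_nonneg.2 (hp1 i)).1 h0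
    refine Finset.sum_le_sum fun i _ => le_of_eq ?_
    rw [show p i = 1 by linarith [h1 i (Finset.mem_univ i)]]

theorem IsLeadingLeftSingularVectors.transpose_mul_self {n d K : ℕ} {hdn : d ≤ n}
    {S : Matrix (Fin n) (Fin K) ℝ} {Ψ : Matrix (Fin n) (Fin d) ℝ}
    (h : IsLeadingLeftSingularVectors hdn S Ψ) : Ψᵀ * Ψ = 1 := by
  obtain ⟨U, hU, V, hV, σ, hσ, hσ0, hS, rfl⟩ := h
  have hU1 : Uᵀ * U = 1 := (Matrix.mem_orthogonalGroup_iff' _ _).1 hU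
  ext i j
  have := congrFun (congrFun hU1 (Fin.castLE hdn i)) (Fin.castLE hdn j)
  simpa [Matrix.mul_apply, Matrix.one_apply] using this

/-- Eckart–Young: the leading singular vectors capture the largest part of `S`. -/
theorem IsLeadingLeftSingularVectors.norm_transpose_mul_le {n d K : ℕ} {hdn : d ≤ n}
    {S : Matrix (Fin n) (Fin K) ℝ} {Ψ : Matrix (Fin n) (Fin d) ℝ}
    (h : IsLeadingLeftSingularVectors hdn S Ψ) {Q : Matrix (Fin n) (Fin d) ℝ} (hQ : Qᵀ * Q = 1) :
    ‖Qᵀ * S‖ ≤ ‖Ψᵀ * S‖ := by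
  have hΨ := h.transpose_mul_self
  obtain ⟨U, hU, V, hV, σ, hσ, hσ0, hS, hΨU⟩ := h
  have hU1 : Uᵀ * U = 1 := (Matrix.mem_orthogonalGroup_iff' _ _).1 hU
  have hU2 : U * Uᵀ = 1 := (Matrix.mem_orthogonalGroup_iff _ _).1 hU
  have hV1 : Vᵀ * V = 1 := (Matrix.mem_orthogonalGroup_iff' _ _).1 hV
  -- `σ` is indexed by `Fin n`, but its entries with index at least `K` do not enter the rectangular
  -- diagonal; `δ` lists the true eigenvalues of `S Sᵀ`.
  set δ : Fin n → ℝ := fun i => if (i : ℕ) < K then σ i ^ 2 else 0 with hδ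
  have hδanti : Antitone δ := by
    intro i j hij
    have hij' : (i : ℕ) ≤ j := hij
    simp only [hδ]
    split_ifs with h1 h2 h2
    · exact pow_le_pow_left₀ (hσ0 j) (hσ hij) 2
    · omega
    · positivity
    · rfl
  have hSS : S * Sᵀ = U * Matrix.diagonal δ * Uᵀ := by
    rw [hS]
    simp only [Matrix.transpose_mul, Matrix.transpose_transpose, Matrix.mul_assoc]
    rw [← Matrix.mul_assoc Vᵀ, hV1, Matrix.one_mul, ← Matrix.mul_assoc _ _ Uᵀ]
    congr 2
    ext i j
    simp only [Matrix.mul_apply, Matrix.of_apply, Matrix.transpose_apply, Matrix.diagonal_apply, hδ]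
    by_cases hij : i = j
    · subst hij
      by_cases hi : (i : ℕ) < K
      · rw [Finset.sum_eq_single ⟨i, hi⟩]
        · simp [hi, sq]
        · intro b _ hb
          have : (i : ℕ) ≠ b := fun h => hb (Fin.ext h.symm)
          simp [this]
        · simp
      · simp only [hi, if_true, if_false]
        refine Finset.sum_eq_zero fun b _ => ?_
        have : (i : ℕ) ≠ b := fun h => hi (h ▸ b.2)
        simp [this]
    · rw [if_neg hij]
      refine Finset.sum_eq_zero fun b _ => ?_
      by_cases hi : (i : ℕ) = b
      · have : (j : ℕ) ≠ b := fun h => hij (Fin.ext (hi.trans h.symm))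
        simp [this]
      · simp [hi]
  -- The captured energy is a weighted sum of the `δ i`, with weights the squared row norms of `Uᵀ
  -- W`; the optimality becomes a rearrangement statement about weights.
  have key : ∀ W : Matrix (Fin n) (Fin d) ℝ,
      ‖Wᵀ * S‖ ^ 2 = ∑ i, δ i * ∑ j, (Uᵀ * W) i j ^ 2 := by
    intro W
    rw [frobenius_norm_sq_eq_trace', Matrix.transpose_mul, Matrix.transpose_transpose,
      Matrix.mul_assoc, ← Matrix.mul_assoc S, hSS, Matrix.trace_mul_comm]
    have : U * Matrix.diagonal δ * Uᵀ * W * Wᵀ = U * (Matrix.diagonal δ * ((Uᵀ * W) * Wᵀ)) := by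
      simp only [Matrix.mul_assoc]
    rw [this, Matrix.trace_mul_comm, Matrix.mul_assoc, Matrix.mul_assoc,
      show Wᵀ * U = (Uᵀ * W)ᵀ by simp]
    generalize Uᵀ * W = Z
    simp [Matrix.trace, Matrix.diagonal_mul, Matrix.mul_apply (M := Z), sq]
  have hUΨ : ∀ i : Fin n, ∑ j, (Uᵀ * Ψ) i j ^ 2 = if (i : ℕ) < d then (1 : ℝ) else 0 := by
    intro i
    have h1 : ∀ j, (Uᵀ * Ψ) i j = if i = Fin.castLE hdn j then 1 else 0 := by
      intro j
      have := congrFun (congrFun hU1 i) (Fin.castLE hdn j)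
      rw [Matrix.one_apply] at this
      rw [← this, hΨU]
      simp [Matrix.mul_apply]
    simp only [h1]
    split_ifs with hi
    · rw [Finset.sum_eq_single ⟨i, hi⟩]
      · simp
      · intro b _ hb
        have : i ≠ Fin.castLE hdn b := fun h => hb (Fin.ext (by simp [h]))
        simp [this]
      · simp
    · refine Finset.sum_eq_zero fun b _ => ?_
      have : i ≠ Fin.castLE hdn b := fun h => hi (by simp [h])
      simp [this]
  apply le_of_sq_le_sq _ (norm_nonneg _)
  rw [key, key]
  simp only [hUΨ]
  have hnorm : ∀ W : Matrix (Fin n) (Fin d) ℝ, Wᵀ * W = 1 →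
      ∑ i, ∑ j, (Uᵀ * W) i j ^ 2 = d := by
    intro W hW
    rw [← frobenius_norm_sq, frobenius_norm_isometry_mul (by simpa using hU2),
      frobenius_norm_sq_eq_trace, hW]
    simp
  have hW1 : (Uᵀ * Q)ᵀ * (Uᵀ * Q) = 1 := by
    rw [Matrix.transpose_mul, Matrix.transpose_transpose, Matrix.mul_assoc, ← Matrix.mul_assoc U,
      hU2, Matrix.one_mul, hQ]
  refine sum_mul_le_sum_leading hδanti (fun i => by positivity) (fun i => ?_) ?_
  -- Testing the contraction `(Uᵀ Q)ᵀ` on the `i`-th unit column bounds the `i`-th row norm of `Uᵀ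
  -- Q` by one.
  · have h1 := frobenius_norm_transpose_isometry_mul_le hW1
      (Matrix.of fun k (_ : Unit) => if k = i then (1 : ℝ) else 0)
    have h2 := pow_le_pow_left₀ (norm_nonneg _) h1 2
    rw [frobenius_norm_sq, frobenius_norm_sq] at h2
    generalize Uᵀ * Q = Z at h2 ⊢
    simpa [Matrix.mul_apply, ite_pow] using h2
  · rw [hnorm Q hQ, ← hnorm Ψ hΨ]
    simp only [hUΨ]

/-- A `sin θ` bound for leading singular subspaces of a perturbation of `J * L`. -/
theorem IsLeadingLeftSingularVectors.mul_norm_compl_le {n d K : ℕ} {hdn : d ≤ n}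
    {S : Matrix (Fin n) (Fin K) ℝ} {Ψ : Matrix (Fin n) (Fin d) ℝ}
    (h : IsLeadingLeftSingularVectors hdn S Ψ) {J : Matrix (Fin n) (Fin d) ℝ} (hJ : Jᵀ * J = 1)
    {L : Matrix (Fin d) (Fin K) ℝ} {E : Matrix (Fin n) (Fin K) ℝ} (hS : S = J * L + E)
    {s : ℝ}
    (hL : ∀ v : Fin d → ℝ, s ^ 2 * (v ⬝ᵥ v) ≤ (v ᵥ* L) ⬝ᵥ (v ᵥ* L)) :
    s * ‖(1 - Ψ * Ψᵀ) * J‖ ≤ 2 * ‖E‖ := by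
  have hΨ := h.transpose_mul_self
  have hpΨ := frobenius_norm_sq_compl_projection (transpose_mul_transpose_self Ψ)
    (mul_transpose_idempotent hΨ) S
  have hpJ := frobenius_norm_sq_compl_projection (transpose_mul_transpose_self J)
    (mul_transpose_idempotent hJ) S
  rw [Matrix.mul_assoc Ψ Ψᵀ S, frobenius_norm_isometry_mul hΨ] at hpΨ
  rw [Matrix.mul_assoc J Jᵀ S, frobenius_norm_isometry_mul hJ] at hpJ
  have hEY := pow_le_pow_left₀ (norm_nonneg _) (h.norm_transpose_mul_le hJ) 2
  have hJE : (1 - J * Jᵀ) * S = (1 - J * Jᵀ) * E := by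
    rw [hS, Matrix.mul_add, ← Matrix.mul_assoc, Matrix.sub_mul 1, Matrix.mul_assoc J, hJ]
    simp
  -- By Eckart–Young, `Ψ` leaves no more residual than `J` does, and `J` leaves only its part of
  -- `E`.
  have h1 : ‖(1 - Ψ * Ψᵀ) * S‖ ≤ ‖E‖ := by
    refine le_trans (le_of_sq_le_sq ?_ (norm_nonneg _))
      (frobenius_norm_compl_projection_mul_le (transpose_mul_transpose_self J)
        (mul_transpose_idempotent hJ) E)
    rw [← hJE]
    linarith
  have h2 := frobenius_norm_compl_projection_mul_le (transpose_mul_transpose_self Ψ)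
        (mul_transpose_idempotent hΨ) E
  calc s * ‖(1 - Ψ * Ψᵀ) * J‖ ≤ ‖(1 - Ψ * Ψᵀ) * J * L‖ := mul_frobenius_norm_le_of_vecMul hL _
    _ = ‖(1 - Ψ * Ψᵀ) * S - (1 - Ψ * Ψᵀ) * E‖ := by
        rw [hS, Matrix.mul_add, add_sub_cancel_right, Matrix.mul_assoc]
    _ ≤ _ := (norm_sub_le _ _).trans (by linarith)

end FrobeniusNorm

/-! ### Second-order Taylor expansion with cubic remainder. -/

section Taylor

variable {E F : Type*} [NormedAddCommGroup E] [NormedSpace ℝ E] [NormedAddCommGroup F]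
  [NormedSpace ℝ F]

/-- Mean value inequality on the closed ball of radius `‖v‖`. It raises the order of vanishing by
one, first for the gradient and then for the map itself. -/
theorem norm_sub_le_of_norm_fderiv_le_pow {g : E → F} {g' : E → E →L[ℝ] F} {C r : ℝ} {k : ℕ}
    (hC : 0 ≤ C) (hg : ∀ v, ‖v‖ < r → HasFDerivAt g (g' v) v)
    (hb : ∀ v, ‖v‖ < r → ‖g' v‖ ≤ C * ‖v‖ ^ k) {v : E} (hv : ‖v‖ < r) :
    ‖g v - g 0‖ ≤ C * ‖v‖ ^ (k + 1) := by
  have h := (convex_closedBall (0 : E) ‖v‖).norm_image_sub_le_of_norm_hasFDerivWithin_le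
    (f := g) (f' := g') (x := 0) (y := v) (C := C * ‖v‖ ^ k) (𝕜 := ℝ)
    (fun w hw => (hg w ((mem_closedBall_zero_iff.1 hw).trans_lt hv)).hasFDerivWithinAt)
    (fun w hw => (hb w ((mem_closedBall_zero_iff.1 hw).trans_lt hv)).trans (by
      have := mem_closedBall_zero_iff.1 hw
      gcongr)) (by simp) (by simp)
  simpa [pow_succ, mul_assoc] using h

/-- Second-order Taylor expansion at `0` of a `C³` map between normed spaces. -/
theorem exists_taylor_two_bound {f : E → F} (hf : ContDiffAt ℝ 3 f 0) :
    ∃ C ≥ 0, ∃ r > 0, ∀ v, ‖v‖ < r →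
      ‖f v - f 0 - fderiv ℝ f 0 v - (1 / 2 : ℝ) • fderiv ℝ (fderiv ℝ f) 0 v v‖ ≤ C * ‖v‖ ^ 3 := by
  have h1 : ContDiffAt ℝ 2 (fderiv ℝ f) 0 := hf.fderiv_right (by norm_num)
  have h2 : ContDiffAt ℝ 1 (fderiv ℝ (fderiv ℝ f)) 0 := h1.fderiv_right (by norm_num)
  have hsymm : IsSymmSndFDerivAt ℝ f 0 := hf.isSymmSndFDerivAt (by simp; norm_num)
  obtain ⟨C, hC, hCO⟩ := (h2.differentiableAt (by simp)).isBigO_sub.exists_pos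
  have hd0 : ∀ᶠ v in 𝓝 (0 : E), DifferentiableAt ℝ f v :=
    (hf.eventually (by simp)).mono fun v hv => hv.differentiableAt (by simp)
  have hd1 : ∀ᶠ v in 𝓝 (0 : E), DifferentiableAt ℝ (fderiv ℝ f) v :=
    (h1.eventually (by simp)).mono fun v hv => hv.differentiableAt (by simp)
  obtain ⟨r, hr, hball⟩ := Metric.eventually_nhds_iff_ball.1 (hd0.and (hd1.and hCO.bound))
  simp only [mem_ball_zero_iff, sub_zero] at hball
  set b := fderiv ℝ (fderiv ℝ f) 0 with hbdef
  have hgrad : ∀ v, ‖v‖ < r → ‖fderiv ℝ f v - fderiv ℝ f 0 - b v‖ ≤ C * ‖v‖ ^ 2 := by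
    intro v hv
    have := norm_sub_le_of_norm_fderiv_le_pow (k := 1) (g := fun v => fderiv ℝ f v - b v)
      (g' := fun v => fderiv ℝ (fderiv ℝ f) v - b) hC.le
      (fun v hv => (hball v hv).2.1.hasFDerivAt.sub b.hasFDerivAt)
      (fun v hv => by simpa using (hball v hv).2.2) hv
    simpa [sub_right_comm] using this
  refine ⟨C, hC.le, r, hr, fun v hv => ?_⟩
  have hq : ∀ v, HasFDerivAt (fun v => (1 / 2 : ℝ) • b v v) (b v) v := by
    intro v
    have h := ((b.hasFDerivAt (x := v)).clm_apply (hasFDerivAt_id v)).const_smul (1 / 2 : ℝ)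
    -- Symmetry of the second derivative merges the two product-rule terms and cancels the factor `1
    -- / 2`.
    have hflip : b.flip v = b v := by
      ext w
      exact hsymm w v
    have hsum : (1 / 2 : ℝ) • (b v ∘SL ContinuousLinearMap.id ℝ E + b.flip (id v)) = b v := by
      rw [ContinuousLinearMap.comp_id, id, hflip, ← two_smul ℝ (b v), smul_smul]
      norm_num
    rw [hsum] at h
    exact h
  have := norm_sub_le_of_norm_fderiv_le_pow (k := 2)
    (g := fun v => f v - fderiv ℝ f 0 v - (1 / 2 : ℝ) • b v v)
    (g' := fun v => fderiv ℝ f v - fderiv ℝ f 0 - b v) hC.le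
    (fun v hv => ((hball v hv).1.hasFDerivAt.sub (fderiv ℝ f 0).hasFDerivAt).sub (hq v))
    hgrad hv
  convert this using 2
  simp only [map_zero, smul_zero, sub_zero]
  abel

end Taylor

/-! ### Quadratic forms and the design matrix. -/

section Design

open scoped Matrix Matrix.Norms.Frobenius

/-- Every quadratic form is a linear combination of the columns of the design matrix. -/
theorem sum_mul_mul_eq_designMatrix {K d : ℕ} (ρ : Matrix (Fin K) (Fin d) ℝ)
    (m : Fin d → Fin d → ℝ) (l : Fin K) :
    ∑ i, ∑ j, m i j * (ρ l i * ρ l j) =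
      ∑ p, designMatrix ρ l p * ((m p.1.1 p.1.2 + m p.1.2 p.1.1) / 2) := by
  set F : Fin d × Fin d → ℝ := fun q => (m q.1 q.2 + m q.2 q.1) / 2 * (ρ l q.1 * ρ l q.2) with hF
  have hFs : ∀ q, F q.swap = F q := by
    intro q
    simp only [hF, Prod.fst_swap, Prod.snd_swap]
    ring
  have h1 : ∑ i, ∑ j, m i j * (ρ l i * ρ l j) = ∑ q, F q := by
    have hswap : ∑ i, ∑ j, m i j * (ρ l i * ρ l j) = ∑ i, ∑ j, m j i * (ρ l i * ρ l j) := by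
      rw [Finset.sum_comm]
      exact Finset.sum_congr rfl fun i _ => Finset.sum_congr rfl fun j _ => by ring
    have : ∑ q, F q = (∑ i, ∑ j, m i j * (ρ l i * ρ l j) +
        ∑ i, ∑ j, m j i * (ρ l i * ρ l j)) / 2 := by
      rw [Fintype.sum_prod_type, ← Finset.sum_add_distrib, Finset.sum_div]
      refine Finset.sum_congr rfl fun i _ => ?_
      rw [← Finset.sum_add_distrib, Finset.sum_div]
      exact Finset.sum_congr rfl fun j _ => by simp only [hF]; ring
    rw [this, ← hswap]
    ring
  -- The factor 2 in the off-diagonal entries counts each pair `i < j` twice; the second copy is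
  -- then moved to the lower triangle by the swap.
  have h2 : ∀ p : QuadIndex d, designMatrix ρ l p * ((m p.1.1 p.1.2 + m p.1.2 p.1.1) / 2) =
      F p.1 + if p.1.1 < p.1.2 then F p.1 else 0 := by
    intro p
    rcases p.2.eq_or_lt with h | h
    · simp only [designMatrix, Matrix.of_apply, h, hF, if_true, lt_irrefl, if_false]
      ring
    · simp only [designMatrix, Matrix.of_apply, h.ne, h, hF, if_true, if_false]
      ring
  rw [h1]
  simp only [h2]
  have hsub : ∀ G : Fin d × Fin d → ℝ, ∑ p : QuadIndex d, G p.1 =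
      ∑ q : Fin d × Fin d, if q.1 ≤ q.2 then G q else 0 := by
    intro G
    rw [← Finset.sum_filter]
    exact (Finset.sum_subtype _ (by simp) G).symm
  rw [Finset.sum_add_distrib, hsub F, hsub fun q => if q.1 < q.2 then F q else 0,
    ← (Equiv.prodComm (Fin d) (Fin d)).sum_comp
      fun q => if q.1 ≤ q.2 then (if q.1 < q.2 then F q else 0) else 0, ← Finset.sum_add_distrib]
  refine Finset.sum_congr rfl fun q _ => ?_
  simp only [Equiv.prodComm_apply, Prod.fst_swap, Prod.snd_swap, hFs]
  by_cases h : q.1 ≤ q.2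
  · simp [h, not_lt.2 h]
  · simp [h, (not_le.1 h), (not_le.1 h).le]

end Design

theorem dotProduct_mulVec_self {m q : Type*} [Fintype m] [Fintype q] (N : Matrix m q ℝ)
    (v : q → ℝ) : N.mulVec v ⬝ᵥ N.mulVec v = v ⬝ᵥ (N.transpose * N).mulVec v := by
  rw [← Matrix.mulVec_mulVec, Matrix.dotProduct_mulVec v, Matrix.vecMul_transpose]

/-! ### The regression projection and its complement. -/

section Projection

open scoped Matrix Matrix.Norms.Frobenius

variable {m q : Type*} [Fintype m] [Fintype q] [DecidableEq q]

theorem regression_projection_transpose (A : Matrix m q ℝ) :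
    (A * (Aᵀ * A)⁻¹ * Aᵀ)ᵀ = A * (Aᵀ * A)⁻¹ * Aᵀ := by
  simp [Matrix.transpose_mul, Matrix.transpose_nonsing_inv, Matrix.mul_assoc]

/-- Holds without invertibility: if `Aᵀ A` is singular, its inverse is the default value `0` and so
is the product. Hence `B` is a contraction for every sample. -/
theorem regression_projection_idempotent (A : Matrix m q ℝ) :
    A * (Aᵀ * A)⁻¹ * Aᵀ * (A * (Aᵀ * A)⁻¹ * Aᵀ) = A * (Aᵀ * A)⁻¹ * Aᵀ := by
  by_cases h : IsUnit (Aᵀ * A).det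
  · calc _ = A * ((Aᵀ * A)⁻¹ * (Aᵀ * A)) * (Aᵀ * A)⁻¹ * Aᵀ := by simp only [Matrix.mul_assoc]
      _ = _ := by rw [Matrix.nonsing_inv_mul _ h, Matrix.mul_one]
  · simp [Matrix.nonsing_inv_apply_not_isUnit _ h]

theorem regression_residual_mul_self [DecidableEq m] {A : Matrix m q ℝ}
    (hA : ∀ v : q → ℝ, A *ᵥ v = 0 → v = 0) : (1 - A * (Aᵀ * A)⁻¹ * Aᵀ) * A = 0 := by
  have h : IsUnit (Aᵀ * A).det := by
    rw [isUnit_iff_ne_zero]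
    intro h0
    obtain ⟨v, hv, hv0⟩ := Matrix.exists_mulVec_eq_zero_iff.2 h0
    refine hv (hA v ?_)
    rw [← dotProduct_self_eq_zero]
    rw [dotProduct_mulVec_self, hv0, dotProduct_zero]
  rw [Matrix.sub_mul, Matrix.mul_assoc, Matrix.mul_assoc, Matrix.nonsing_inv_mul _ h]
  simp

end Projection

/-! ### From the eigenvalue gap to a lower bound on the projected coordinates. -/

section Gap

open scoped Matrix

/-- The Gram matrix `J G Jᵀ` is positive semidefinite and, as `d < n`, has a further eigenvalue
after the first `d`. That one is nonnegative, so each of the first `d` exceeds `g`; they are exactly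
the eigenvalues of `G`. -/
theorem HasSpectralGap.le_gram {n d K : ℕ} (hdn : d < n) {J : Matrix (Fin n) (Fin d) ℝ}
    (hJ : Jᵀ * J = 1) {C : Matrix (Fin K) (Fin d) ℝ} {B : Matrix (Fin K) (Fin K) ℝ} {g : ℝ}
    (hg : 0 ≤ g) (h : HasSpectralGap d (C * Jᵀ) B g) (v : Fin d → ℝ) :
    g * (v ⬝ᵥ v) ≤ (B * C) *ᵥ v ⬝ᵥ (B * C) *ᵥ v := by
  set H := isHermitian_gram (C * Jᵀ) B with hH
  set e : Fin n ≃ Fin n := (finCongr (Fintype.card_fin n).symm).trans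
    (Fintype.equivOfCardEq (Fintype.card_fin _)) with he
  have heig : ∀ i, gramEigenvalue (C * Jᵀ) B i = H.eigenvalues (e i) := by
    intro i
    simp [gramEigenvalue, Matrix.IsHermitian.eigenvalues, he]
  have hpsd : ((C * Jᵀ)ᵀ * Bᵀ * B * (C * Jᵀ)).PosSemidef := by
    have := Matrix.posSemidef_conjTranspose_mul_self (B * (C * Jᵀ))
    simpa only [Matrix.conjTranspose_eq_transpose_of_trivial, Matrix.transpose_mul,
      Matrix.mul_assoc] using this
  have hlam : ∀ i : Fin d, g < H.eigenvalues (e (Fin.castLE hdn.le i)) := by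
    intro i
    have h1 := h (Fin.castLE hdn.le i) ⟨d, hdn⟩ (by simp) (fun hh => by
      have := congrArg Fin.val hh
      have := i.2
      simp at *
      omega)
    have h2 : gramEigenvalue (C * Jᵀ) B ⟨d, hdn⟩ ≤
        gramEigenvalue (C * Jᵀ) B (Fin.castLE hdn.le i) := by
      apply H.eigenvalues₀_antitone
      simp only [Fin.le_def, Fin.val_cast, Fin.val_castLE]
      exact i.2.le
    have h3 : 0 ≤ gramEigenvalue (C * Jᵀ) B ⟨d, hdn⟩ := by
      rw [heig]
      exact hpsd.eigenvalues_nonneg _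
    rw [abs_of_nonneg (sub_nonneg.2 h2), ← heig] at *
    linarith
  set lam : Fin d → ℝ := fun i => H.eigenvalues (e (Fin.castLE hdn.le i)) with hlamdef
  set W : Matrix (Fin n) (Fin d) ℝ :=
    Matrix.of fun s i => H.eigenvectorBasis (e (Fin.castLE hdn.le i)) s with hW
  have hWW : Wᵀ * W = 1 := by
    ext i j
    have h1 := orthonormal_iff_ite.1 H.eigenvectorBasis.orthonormal
      (e (Fin.castLE hdn.le i)) (e (Fin.castLE hdn.le j))
    simp only [EmbeddingLike.apply_eq_iff_eq, (Fin.castLE_injective hdn.le).eq_iff] at h1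
    rw [Matrix.one_apply, ← h1]
    simp [Matrix.mul_apply, hW, PiLp.inner_apply, mul_comm]
  set G := Cᵀ * Bᵀ * B * C with hG
  have hMW : (J * G * Jᵀ) * W = W * Matrix.diagonal lam := by
    have hM : J * G * Jᵀ = (C * Jᵀ)ᵀ * Bᵀ * B * (C * Jᵀ) := by
      simp [hG, Matrix.mul_assoc]
    ext s i
    rw [hM]
    have h1 := congrFun (H.mulVec_eigenvectorBasis (e (Fin.castLE hdn.le i))) s
    rw [Matrix.mul_diagonal]
    rw [Matrix.mul_apply]
    simpa [Matrix.mulVec, dotProduct, hW, hlamdef, mul_comm] using h1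
  have hlam0 : ∀ i, lam i ≠ 0 := fun i => (hg.trans_lt (hlam i)).ne'
  -- Eigenvectors with nonzero eigenvalue lie in the range of `J`, so `Jᵀ W` is a square orthogonal
  -- matrix diagonalizing `G`.
  have hJW : J * (Jᵀ * W) = W := by
    have h1 : J * (Jᵀ * (W * Matrix.diagonal lam)) = W * Matrix.diagonal lam := by
      rw [← hMW]
      calc _ = J * (Jᵀ * J) * G * Jᵀ * W := by simp only [Matrix.mul_assoc]
        _ = _ := by rw [hJ, Matrix.mul_one]
    have h2 : Matrix.diagonal lam * Matrix.diagonal (fun i => (lam i)⁻¹) = 1 := by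
      rw [Matrix.diagonal_mul_diagonal, ← Matrix.diagonal_one]
      congr 1
      ext i
      exact mul_inv_cancel₀ (hlam0 i)
    calc J * (Jᵀ * W) = J * (Jᵀ * (W * (Matrix.diagonal lam *
          Matrix.diagonal (fun i => (lam i)⁻¹)))) := by rw [h2, Matrix.mul_one]
      _ = (J * (Jᵀ * (W * Matrix.diagonal lam))) * Matrix.diagonal (fun i => (lam i)⁻¹) := by
          simp only [Matrix.mul_assoc]
      _ = W := by rw [h1, Matrix.mul_assoc, h2, Matrix.mul_one]
  set Q := Jᵀ * W with hQ
  have hQQ : Qᵀ * Q = 1 := by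
    rw [show Qᵀ = Wᵀ * J by simp [hQ], Matrix.mul_assoc, hJW, hWW]
  have hQQ' : Q * Qᵀ = 1 := mul_eq_one_comm.1 hQQ
  have hGQ : G = Q * Matrix.diagonal lam * Qᵀ := by
    have h1 : G * Q = Q * Matrix.diagonal lam := by
      calc G * Q = (Jᵀ * J) * G * Jᵀ * W := by rw [hJ, Matrix.one_mul, hQ, Matrix.mul_assoc G]
        _ = Jᵀ * (J * G * Jᵀ * W) := by simp only [Matrix.mul_assoc]
        _ = _ := by rw [hMW, hQ, Matrix.mul_assoc]
    rw [← h1, Matrix.mul_assoc, hQQ', Matrix.mul_one]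
  have hlhs : (B * C) *ᵥ v ⬝ᵥ (B * C) *ᵥ v = v ⬝ᵥ (G *ᵥ v) := by
    rw [show G = (B * C)ᵀ * (B * C) by simp [hG, Matrix.mul_assoc],
      dotProduct_mulVec_self]
  have hz : v ⬝ᵥ v = (Qᵀ *ᵥ v) ⬝ᵥ (Qᵀ *ᵥ v) := by
    rw [Matrix.dotProduct_mulVec, ← Matrix.mulVec_transpose, Matrix.transpose_transpose,
      Matrix.mulVec_mulVec, hQQ', Matrix.one_mulVec]
  have hrhs : v ⬝ᵥ (G *ᵥ v) = (Qᵀ *ᵥ v) ⬝ᵥ (Matrix.diagonal lam *ᵥ (Qᵀ *ᵥ v)) := by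
    rw [hGQ, ← Matrix.mulVec_mulVec, ← Matrix.mulVec_mulVec, Matrix.dotProduct_mulVec,
      ← Matrix.mulVec_transpose]
  rw [hlhs, hrhs, hz]
  simp only [dotProduct, Matrix.mulVec_diagonal, Finset.mul_sum]
  refine Finset.sum_le_sum fun i _ => ?_
  nlinarith [mul_le_mul_of_nonneg_right (hlam i).le (mul_self_nonneg ((Qᵀ *ᵥ v) i))]

end Gap

/-! ### Perturbation and full column rank of the design matrix. -/

section Design

open scoped Matrix Matrix.Norms.Frobenius

theorem designMatrix_zero {K d : ℕ} : designMatrix (0 : Matrix (Fin K) (Fin d) ℝ) = 0 := by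
  ext l p
  simp [designMatrix]

/-- A linear change of coordinates acts linearly on the design matrix. -/
theorem exists_designMatrix_mul {d : ℕ} (N : Matrix (Fin d) (Fin d) ℝ) :
    ∃ S : Matrix (QuadIndex d) (QuadIndex d) ℝ, ∀ {K : ℕ} (ρ : Matrix (Fin K) (Fin d) ℝ),
      designMatrix (ρ * N) = designMatrix ρ * S := by
  let m (p : QuadIndex d) (i j : Fin d) : ℝ :=
    (if p.1.1 = p.1.2 then 1 else 2) * (N i p.1.1 * N j p.1.2)
  refine ⟨Matrix.of fun p' p => (m p p'.1.1 p'.1.2 + m p p'.1.2 p'.1.1) / 2, fun ρ => ?_⟩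
  ext l p
  simp only [Matrix.mul_apply (M := designMatrix ρ), Matrix.of_apply]
  rw [← sum_mul_mul_eq_designMatrix ρ (m p) l]
  have h : ∑ i, ∑ j, m p i j * (ρ l i * ρ l j) =
      (if p.1.1 = p.1.2 then 1 else 2) * ((ρ * N) l p.1.1 * (ρ * N) l p.1.2) := by
    rw [Matrix.mul_apply, Matrix.mul_apply, Finset.sum_mul_sum, Finset.mul_sum]
    refine Finset.sum_congr rfl fun i _ => ?_
    rw [Finset.mul_sum]
    exact Finset.sum_congr rfl fun j _ => by simp only [m]; ring
  rw [h]
  simp only [designMatrix, Matrix.of_apply]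
  split_ifs with hp
  · rw [hp]; ring
  · rfl

theorem norm_designMatrix_sub_le {K d : ℕ} (X Z : Matrix (Fin K) (Fin d) ℝ) :
    ‖designMatrix X - designMatrix Z‖ ≤
      (K * Fintype.card (QuadIndex d)) * (2 * (‖X - Z‖ * (‖X‖ + ‖Z‖))) := by
  have h := frobenius_norm_le_of_abs_le (S := designMatrix X - designMatrix Z)
    (b := 2 * (‖X - Z‖ * (‖X‖ + ‖Z‖))) (by positivity) ?_
  · simpa using h
  intro l p
  have hprod : ∀ i j, |X l i * X l j - Z l i * Z l j| ≤ ‖X - Z‖ * (‖X‖ + ‖Z‖) := by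
    intro i j
    have hi := abs_entry_le_frobenius_norm (X - Z) l i
    have hj := abs_entry_le_frobenius_norm (X - Z) l j
    rw [Matrix.sub_apply] at hi hj
    calc |X l i * X l j - Z l i * Z l j|
        = |(X l i - Z l i) * X l j + Z l i * (X l j - Z l j)| := by ring_nf
      _ ≤ |X l i - Z l i| * |X l j| + |Z l i| * |X l j - Z l j| := by
          rw [← abs_mul, ← abs_mul]; exact abs_add_le _ _
      _ ≤ ‖X - Z‖ * ‖X‖ + ‖Z‖ * ‖X - Z‖ := by
          gcongr
          · exact abs_entry_le_frobenius_norm X l j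
          · exact abs_entry_le_frobenius_norm Z l i
      _ = _ := by ring
  have h1 := hprod p.1.1 p.1.2
  have h0 : 0 ≤ ‖X - Z‖ * (‖X‖ + ‖Z‖) := by positivity
  simp only [designMatrix, Matrix.sub_apply, Matrix.of_apply]
  split_ifs with hp
  · rw [← hp] at h1
    rw [sq, sq]
    linarith
  · rw [← mul_sub, abs_mul, abs_two]
    linarith

/-- The quotient `σ_max / (σ_max / σ_min)` is `σ_min` when `σ_max ≠ 0`, also for `σ_min = 0` under
division by zero, and it is `0` when `σ_max = 0`. -/
theorem spectralNorm_div_conditionNumber_le {m q : Type} [Fintype m] [Fintype q] [DecidableEq q]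
    (S : Matrix m q ℝ) : spectralNorm S / conditionNumber S ≤ minSingularValue S := by
  have hmin : 0 ≤ minSingularValue S := Real.iInf_nonneg fun _ => norm_nonneg _
  by_cases hs : spectralNorm S = 0
  · simpa [hs] using hmin
  · rw [conditionNumber, div_div_cancel₀ hs]

theorem minSingularValue_mul_norm_le {m q : Type} [Fintype m] [Fintype q] [DecidableEq q]
    (S : Matrix m q ℝ) (v : EuclideanSpace ℝ q) :
    minSingularValue S * ‖v‖ ≤ ‖Matrix.toEuclideanLin S v‖ := by
  rcases eq_or_ne v 0 with rfl | hv
  · simp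
  have hv' : ‖v‖ ≠ 0 := norm_ne_zero_iff.2 hv
  have hmem : ‖v‖⁻¹ • v ∈ Metric.sphere (0 : EuclideanSpace ℝ q) 1 := by
    simp [norm_smul, hv']
  have h1 : minSingularValue S ≤ ‖Matrix.toEuclideanLin S (‖v‖⁻¹ • v)‖ :=
    ciInf_le ⟨0, by rintro _ ⟨w, rfl⟩; exact norm_nonneg _⟩
      (⟨_, hmem⟩ : Metric.sphere (0 : EuclideanSpace ℝ q) 1)
  rw [map_smul, norm_smul, norm_inv, norm_norm] at h1
  rw [inv_mul_eq_div, le_div_iff₀ (by positivity)] at h1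
  exact h1

theorem norm_toEuclideanLin_le_frobenius {m q : Type} [Fintype m] [Fintype q] [DecidableEq q]
    (S : Matrix m q ℝ) (v : EuclideanSpace ℝ q) :
    ‖Matrix.toEuclideanLin S v‖ ≤ ‖S‖ * ‖v‖ := by
  have h := Matrix.frobenius_norm_mul S (Matrix.replicateCol Unit v)
  rw [← Matrix.replicateCol_mulVec, Matrix.frobenius_norm_replicateCol,
    Matrix.frobenius_norm_replicateCol] at h
  simpa [Matrix.toLpLin_apply] using h

/-- If `A = A' * S + E` with `E` smaller than the least singular value of `A`, then the columns of
`A'` are linearly independent. -/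
theorem mulVec_eq_zero_of_norm_lt_minSingularValue {m q : Type} [Fintype m] [Fintype q]
    [DecidableEq q] {A A' E : Matrix m q ℝ} {S : Matrix q q ℝ} (hA : A = A' * S + E)
    (hE : ‖E‖ < minSingularValue A) (v : q → ℝ) (hv : A' *ᵥ v = 0) : v = 0 := by
  have hzero : ∀ w : q → ℝ, A' *ᵥ (S *ᵥ w) = 0 → w = 0 := by
    intro w hw
    have hAw : A *ᵥ w = E *ᵥ w := by
      rw [hA, Matrix.add_mulVec, ← Matrix.mulVec_mulVec, hw, zero_add]
    have h1 := minSingularValue_mul_norm_le A (WithLp.toLp 2 w)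
    have h2 := norm_toEuclideanLin_le_frobenius E (WithLp.toLp 2 w)
    have h3 : Matrix.toEuclideanLin A (WithLp.toLp 2 w) =
        Matrix.toEuclideanLin E (WithLp.toLp 2 w) := by
      simp [Matrix.toLpLin_apply, hAw]
    rw [h3] at h1
    by_contra hne
    have hpos : 0 < ‖(WithLp.toLp 2 w : EuclideanSpace ℝ q)‖ := by
      rw [norm_pos_iff]
      simpa using hne
    nlinarith
  -- Injectivity of `A' S` forces that of the square matrix `S`, which is then surjective; so every
  -- `v` has the form `S w`.
  have hinj : Function.Injective S.mulVecLin := by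
    rw [injective_iff_map_eq_zero]
    intro w hw
    exact hzero w (by rw [show S *ᵥ w = 0 from hw, Matrix.mulVec_zero])
  obtain ⟨w, rfl⟩ := LinearMap.surjective_of_injective hinj v
  have := hzero w hv
  rw [this, map_zero]

end Design

/-! ### Expansion of the neighbour differences in tangential coordinates. -/

section Expansion

open scoped Matrix Matrix.Norms.Frobenius

theorem eq_sum_smul_single {d : ℕ} (v : EuclideanSpace ℝ (Fin d)) :
    v = ∑ j, v j • EuclideanSpace.single j (1 : ℝ) := by
  ext i
  simp [Pi.single_apply]

theorem norm_le_of_abs_le {d : ℕ} {v : EuclideanSpace ℝ (Fin d)} {s : ℝ} (h : ∀ j, |v j| ≤ s) :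
    ‖v‖ ≤ d * s := by
  calc ‖v‖ = ‖∑ j, v j • EuclideanSpace.single j (1 : ℝ)‖ := by rw [← eq_sum_smul_single]
    _ ≤ ∑ j, ‖v j • EuclideanSpace.single j (1 : ℝ)‖ := norm_sum_le _ _
    _ ≤ ∑ _j : Fin d, s := Finset.sum_le_sum fun j _ => by
        simpa [norm_smul] using h j
    _ = d * s := by simp

theorem tangentialResidual_eq {n d K : ℕ}
    (ι : EuclideanSpace ℝ (Fin d) → EuclideanSpace ℝ (Fin n))
    (ρ : Fin K → EuclideanSpace ℝ (Fin d)) :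
    tangentialResidual ι ρ = coordMatrix ρ * (jacobian ι)ᵀ := by
  ext l s
  simp [tangentialResidual, coordMatrix, Matrix.mul_apply]

/-- Second-order expansion of the difference matrix. -/
theorem exists_neighbourDifferences_expansion {n d : ℕ} (K : ℕ)
    {ι : EuclideanSpace ℝ (Fin d) → EuclideanSpace ℝ (Fin n)} (hι : ContDiffAt ℝ 3 ι 0) :
    ∃ Y : Matrix (QuadIndex d) (Fin n) ℝ, ∃ C ≥ 0, ∃ r > 0, ∀ s, 0 ≤ s → s < r →
      ∀ ρ : Fin K → EuclideanSpace ℝ (Fin d), (∀ l j, |ρ l j| ≤ s) →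
      ∃ E : Matrix (Fin K) (Fin n) ℝ,
        (neighbourDifferences ι ρ)ᵀ = coordMatrix ρ * (jacobian ι)ᵀ +
          designMatrix (coordMatrix ρ) * Y + E ∧ ‖E‖ ≤ C * s ^ 3 := by
  obtain ⟨C, hC, r, hr, hT⟩ := exists_taylor_two_bound hι
  set b := fderiv ℝ (fderiv ℝ ι) 0 with hb
  let m (t : Fin n) (i j : Fin d) : ℝ :=
    1 / 2 * b (EuclideanSpace.single i 1) (EuclideanSpace.single j 1) t
  -- The Euclidean norm is at most `d s`, whence `d ^ 3` in the constant; the radius is divided by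
  -- `d + 1` rather than `d` to allow `d = 0`.
  refine ⟨Matrix.of fun p t => (m t p.1.1 p.1.2 + m t p.1.2 p.1.1) / 2,
    K * n * (C * d ^ 3), by positivity, r / (d + 1), by positivity, fun s hs hsr ρ hρ => ?_⟩
  rw [lt_div_iff₀ (by positivity)] at hsr
  have hnorm : ∀ l, ‖ρ l‖ ≤ d * s := fun l => norm_le_of_abs_le (hρ l)
  refine ⟨Matrix.of fun l t => (ι (ρ l) - ι 0 - fderiv ℝ ι 0 (ρ l) - (1 / 2 : ℝ) • b (ρ l) (ρ l)) t,
    ?_, ?_⟩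
  · ext l t
    have hlin : (coordMatrix ρ * (jacobian ι)ᵀ) l t = fderiv ℝ ι 0 (ρ l) t := by
      conv_rhs => rw [eq_sum_smul_single (ρ l)]
      simp [Matrix.mul_apply, coordMatrix, jacobian]
    have hquad : (designMatrix (coordMatrix ρ) * Matrix.of fun (p : QuadIndex d) t =>
        (m t p.1.1 p.1.2 + m t p.1.2 p.1.1) / 2) l t = 1 / 2 * b (ρ l) (ρ l) t := by
      rw [Matrix.mul_apply]
      simp only [Matrix.of_apply]
      rw [← sum_mul_mul_eq_designMatrix (coordMatrix ρ) (m t) l]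
      conv_rhs => rw [eq_sum_smul_single (ρ l)]
      simp only [map_sum, map_smul, sum_apply, smul_apply, WithLp.ofLp_sum, Finset.sum_apply,
        PiLp.smul_apply, smul_eq_mul, Finset.mul_sum, m, coordMatrix, Matrix.of_apply, Finset.smul_sum]
      rw [Finset.sum_comm]
      exact Finset.sum_congr rfl fun i _ => Finset.sum_congr rfl fun j _ => by ring
    rw [Matrix.add_apply, Matrix.add_apply, hlin, hquad]
    simp [neighbourDifferences, differenceMatrix]
  · have h := frobenius_norm_le_of_abs_le (b := C * (d * s) ^ 3) (S := Matrix.of fun l t =>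
      (ι (ρ l) - ι 0 - fderiv ℝ ι 0 (ρ l) - (1 / 2 : ℝ) • b (ρ l) (ρ l)) t) (by positivity) ?_
    · refine h.trans (le_of_eq ?_)
      simp only [Fintype.card_fin]
      ring
    · intro l t
      have h1 := hT (ρ l) ((hnorm l).trans_lt (by nlinarith))
      calc _ ≤ ‖ι (ρ l) - ι 0 - fderiv ℝ ι 0 (ρ l) - (1 / 2 : ℝ) • b (ρ l) (ρ l)‖ :=
            PiLp.norm_apply_le _ t
        _ ≤ C * ‖ρ l‖ ^ 3 := h1
        _ ≤ _ := by
          gcongr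
          exact hnorm l

end Expansion

/-! ### Error analysis of the two-stage estimator. -/

section Estimator

open scoped Matrix Matrix.Norms.Frobenius

theorem twoResidual_eq {n d K : ℕ} (D : Matrix (Fin n) (Fin K) ℝ) (T : Matrix (Fin n) (Fin d) ℝ) :
    twoResidual D T = (2 : ℝ) • (residualProjection D T * Dᵀ)ᵀ := by
  rw [twoResidual, estimatedHessian, residualProjection, Matrix.mul_smul, Matrix.transpose_smul,
    ← smul_sub, Matrix.sub_mul, Matrix.transpose_sub]
  simp only [Matrix.one_mul, Matrix.transpose_transpose, Matrix.mul_assoc]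

theorem norm_residualProjection_mul_le {n d K : ℕ} {q : Type*} [Fintype q]
    (D : Matrix (Fin n) (Fin K) ℝ) (T : Matrix (Fin n) (Fin d) ℝ) (S : Matrix (Fin K) q ℝ) :
    ‖residualProjection D T * S‖ ≤ ‖S‖ :=
  frobenius_norm_compl_projection_mul_le (regression_projection_transpose _)
    (regression_projection_idempotent _) S

theorem dotProduct_residualProjection_mulVec_le {n d K : ℕ} (D : Matrix (Fin n) (Fin K) ℝ)
    (T : Matrix (Fin n) (Fin d) ℝ) (v : Fin K → ℝ) :
    residualProjection D T *ᵥ v ⬝ᵥ residualProjection D T *ᵥ v ≤ v ⬝ᵥ v := by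
  have h := norm_residualProjection_mul_le D T (Matrix.replicateCol Unit v)
  have h2 := pow_le_pow_left₀ (norm_nonneg _) h 2
  rw [← Matrix.replicateCol_mulVec, frobenius_norm_sq, frobenius_norm_sq] at h2
  simpa [dotProduct, sq] using h2

/-- The error of the coordinates measured in the estimated frame `T`, after the change of frame
`Tᵀ J`. -/
theorem norm_coord_sub_le {n d K : ℕ} {D : Matrix (Fin n) (Fin K) ℝ}
    {J T : Matrix (Fin n) (Fin d) ℝ} (hJ : Jᵀ * J = 1) {C : Matrix (Fin K) (Fin d) ℝ}
    {E : Matrix (Fin K) (Fin n) ℝ} (hD : Dᵀ = C * Jᵀ + E) :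
    ‖C - Dᵀ * T * (Tᵀ * J)‖ ≤ ‖E‖ + (‖C‖ + ‖E‖) * ‖(1 - T * Tᵀ) * J‖ := by
  have h1 : C - Dᵀ * T * (Tᵀ * J) = Dᵀ * ((1 - T * Tᵀ) * J) - E * J := by
    have h2 : Dᵀ * J = C + E * J := by
      rw [hD, Matrix.add_mul, Matrix.mul_assoc, hJ, Matrix.mul_one]
    rw [Matrix.sub_mul, Matrix.one_mul, Matrix.mul_sub, h2]
    simp only [Matrix.mul_assoc]
    abel
  have hDn : ‖Dᵀ‖ ≤ ‖C‖ + ‖E‖ := by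
    rw [hD]
    refine (norm_add_le _ _).trans (add_le_add_left (le_of_eq ?_) _)
    rw [← Matrix.frobenius_norm_transpose, Matrix.transpose_mul, Matrix.transpose_transpose,
      frobenius_norm_isometry_mul hJ, Matrix.frobenius_norm_transpose]
  rw [h1]
  refine (norm_sub_le _ _).trans ?_
  rw [add_comm]
  gcongr
  · exact frobenius_norm_mul_isometry_le hJ E
  · exact (Matrix.frobenius_norm_mul _ _).trans (by gcongr)

set_option maxHeartbeats 1000000 in
/-- The deterministic error bound for the second-order estimator, with `s = √ε`. -/
theorem exists_norm_projection_sub_le {n d K : ℕ} (hdn : d < n)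
    {ι : EuclideanSpace ℝ (Fin d) → EuclideanSpace ℝ (Fin n)} (hι : ContDiffAt ℝ 3 ι 0)
    (hJ : (jacobian ι)ᵀ * jacobian ι = 1) {c : ℝ} (hc : 0 < c) :
    ∃ C ≥ 0, ∃ e ≥ 0, ∃ r > 0, ∀ s, 0 < s → s < r →
      ∀ ρ : Fin K → EuclideanSpace ℝ (Fin d), (∀ l j, |ρ l j| ≤ s) →
      ∀ T Ψ : Matrix (Fin n) (Fin d) ℝ,
        IsSecondOrderSVD hdn.le (neighbourDifferences ι ρ) T Ψ →
        e * s ^ 3 < minSingularValue (designMatrix (coordMatrix ρ)) →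
        HasSpectralGap d (tangentialResidual ι ρ)
          (residualProjection (neighbourDifferences ι ρ) T) (c * s ^ 2) →
        ‖Ψ * Ψᵀ - jacobian ι * (jacobian ι)ᵀ‖ ≤ C * s ^ 2 := by
  obtain ⟨Y, c₀, hc₀, r, hr, hexp⟩ := exists_neighbourDifferences_expansion K hι
  set κ : ℝ := (K * Fintype.card (QuadIndex d)) * 2 with hκ
  set a : ℝ := K * d with ha
  -- Error constants: `e₁ s²` for curvature plus remainder, `x₁ s` for the tilt of `T`, `e₂ s²` for
  -- the coordinates, `e₃ s³` for the design matrix, `f s³` for the signal after regression.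
  set e₁ : ℝ := κ * (a * a) * ‖Y‖ + c₀ with he₁
  set x₁ : ℝ := 2 * e₁ / √c with hx₁
  set e₂ : ℝ := e₁ + (a + e₁) * x₁ with he₂
  set e₃ : ℝ := κ * (e₂ * (2 * a + e₂)) with he₃
  set f : ℝ := e₃ * ‖Y‖ + c₀ with hf
  have hκ0 : 0 ≤ κ := by positivity
  have ha0 : 0 ≤ a := by positivity
  have he₁0 : 0 ≤ e₁ := by positivity
  have hx₁0 : 0 ≤ x₁ := by positivity
  have he₂0 : 0 ≤ e₂ := by positivity
  have he₃0 : 0 ≤ e₃ := by positivity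
  have hf0 : 0 ≤ f := by positivity
  have hsc : 0 < √c := Real.sqrt_pos.2 hc
  refine ⟨2 * (2 * f / √c), by positivity, e₃, he₃0, min r 1, by positivity, ?_⟩
  intro s hs hsr ρ hρ T Ψ hSVD hmin hgap
  have hs1 : s ≤ 1 := (hsr.trans_le (min_le_right _ _)).le
  obtain ⟨E, hD, hE⟩ := hexp s hs.le (hsr.trans_le (min_le_left _ _)) ρ hρ
  set D := neighbourDifferences ι ρ with hDdef
  set J := jacobian ι with hJdef
  set C := coordMatrix ρ with hCdef
  set A := designMatrix C with hA
  set B := residualProjection D T with hB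
  have hs21 : s ^ 2 ≤ s := pow_le_of_le_one hs.le hs1 two_ne_zero
  have hs32 : s ^ 3 ≤ s ^ 2 := pow_le_pow_of_le_one hs.le hs1 (by norm_num)
  have hCn : ‖C‖ ≤ a * s := by
    have := frobenius_norm_le_of_abs_le (S := C) hs.le (fun l j => hρ l j)
    simpa using this
  have hAn : ‖A‖ ≤ κ * (a * a) * s ^ 2 := by
    have h1 := norm_designMatrix_sub_le C 0
    rw [designMatrix_zero, sub_zero, sub_zero, norm_zero, add_zero] at h1
    calc ‖A‖ ≤ κ * (‖C‖ * ‖C‖) := h1.trans (le_of_eq (by rw [hκ]; ring))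
      _ ≤ κ * ((a * s) * (a * s)) := by gcongr
      _ = _ := by ring
  have hE₁ : ‖A * Y + E‖ ≤ e₁ * s ^ 2 := by
    calc ‖A * Y + E‖ ≤ ‖A‖ * ‖Y‖ + ‖E‖ :=
          (norm_add_le _ _).trans (add_le_add_left (Matrix.frobenius_norm_mul _ _) _)
      _ ≤ κ * (a * a) * s ^ 2 * ‖Y‖ + c₀ * s ^ 2 := by
          gcongr
          exact hE.trans (by gcongr)
      _ = _ := by rw [he₁]; ring
  have hD₁ : Dᵀ = C * Jᵀ + (A * Y + E) := by rw [hD, add_assoc]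
  have hlow : ∀ v : Fin d → ℝ, (√c * s) ^ 2 * (v ⬝ᵥ v) ≤ (B * C) *ᵥ v ⬝ᵥ (B * C) *ᵥ v := by
    intro v
    rw [tangentialResidual_eq] at hgap
    have := hgap.le_gram hdn hJ (by positivity) v
    rwa [mul_pow, Real.sq_sqrt hc.le]
  have hX : ‖(1 - T * Tᵀ) * J‖ ≤ x₁ * s := by
    have h1 := hSVD.1.mul_norm_compl_le hJ (L := Cᵀ) (E := (A * Y + E)ᵀ) (s := √c * s)
      (by rw [← Matrix.transpose_transpose D, hD₁]; simp) (fun v => by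
        rw [Matrix.vecMul_transpose]
        refine (hlow v).trans ?_
        rw [← Matrix.mulVec_mulVec]
        exact dotProduct_residualProjection_mulVec_le D T _)
    rw [Matrix.frobenius_norm_transpose] at h1
    have h2 : √c * s * ‖(1 - T * Tᵀ) * J‖ ≤ √c * s * (x₁ * s) := by
      refine (h1.trans (mul_le_mul_of_nonneg_left hE₁ zero_le_two)).trans (le_of_eq ?_)
      rw [hx₁]
      field_simp
    exact le_of_mul_le_mul_left h2 (by positivity)
  have hE₂ : ‖C - Dᵀ * T * (Tᵀ * J)‖ ≤ e₂ * s ^ 2 := by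
    refine (norm_coord_sub_le hJ hD₁).trans ?_
    calc _ ≤ e₁ * s ^ 2 + (a * s + e₁ * s) * (x₁ * s) := by
          gcongr
          exact hE₁.trans (by gcongr)
      _ = _ := by rw [he₂]; ring
  obtain ⟨S, hS⟩ := exists_designMatrix_mul (Tᵀ * J)
  have hE₃ : ‖A - estimatedDesign D T * S‖ ≤ e₃ * s ^ 3 := by
    rw [estimatedDesign, ← hS]
    have hZ : ‖Dᵀ * T * (Tᵀ * J)‖ ≤ a * s + e₂ * s := by
      calc ‖Dᵀ * T * (Tᵀ * J)‖ = ‖C - (C - Dᵀ * T * (Tᵀ * J))‖ := by rw [sub_sub_cancel]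
        _ ≤ ‖C‖ + ‖C - Dᵀ * T * (Tᵀ * J)‖ := norm_sub_le _ _
        _ ≤ _ := add_le_add hCn (hE₂.trans (by gcongr))
    calc _ ≤ κ * (‖C - Dᵀ * T * (Tᵀ * J)‖ * (‖C‖ + ‖Dᵀ * T * (Tᵀ * J)‖)) :=
          (norm_designMatrix_sub_le _ _).trans (le_of_eq (by rw [hκ]; ring))
      _ ≤ κ * ((e₂ * s ^ 2) * (a * s + (a * s + e₂ * s))) := by gcongr
      _ = _ := by rw [he₃]; ring
  set E₃ := A - estimatedDesign D T * S with hE₃def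
  -- Condition (i) enters here, and only to give `Ã` independent columns; no bound on the inverse of
  -- `S` or of `Ãᵀ Ã` is needed.
  have hAeq : A = estimatedDesign D T * S + E₃ := by rw [hE₃def]; abel
  have hBA : B * estimatedDesign D T = 0 :=
    regression_residual_mul_self
      (mulVec_eq_zero_of_norm_lt_minSingularValue hAeq (hE₃.trans_lt hmin))
  have hBD : B * Dᵀ = B * C * Jᵀ + B * (E₃ * Y + E) := by
    have hBAE : B * A = B * E₃ := by
      rw [hAeq, Matrix.mul_add, ← Matrix.mul_assoc, hBA, Matrix.zero_mul, zero_add]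
    rw [hD, Matrix.mul_add, Matrix.mul_add, Matrix.mul_add, ← Matrix.mul_assoc, ← Matrix.mul_assoc,
      ← Matrix.mul_assoc, hBAE, add_assoc]
  have hF : ‖B * (E₃ * Y + E)‖ ≤ f * s ^ 3 := by
    calc _ ≤ ‖E₃ * Y + E‖ := norm_residualProjection_mul_le D T _
      _ ≤ ‖E₃‖ * ‖Y‖ + ‖E‖ :=
          (norm_add_le _ _).trans (add_le_add_left (Matrix.frobenius_norm_mul _ _) _)
      _ ≤ e₃ * s ^ 3 * ‖Y‖ + c₀ * s ^ 3 := by gcongr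
      _ = _ := by rw [hf]; ring
  have hΨX : ‖(1 - Ψ * Ψᵀ) * J‖ ≤ 2 * f / √c * s ^ 2 := by
    -- Signal and error both carry the factor 2 of `twoResidual`, which cancels from the bound.
    have h1 := hSVD.2.mul_norm_compl_le hJ (L := (2 : ℝ) • (B * C)ᵀ)
      (E := (2 : ℝ) • (B * (E₃ * Y + E))ᵀ) (s := 2 * (√c * s))
      (by
        rw [twoResidual_eq, hBD, Matrix.transpose_add, Matrix.transpose_mul _ Jᵀ,
          Matrix.transpose_transpose, smul_add, Matrix.mul_smul])
      (fun v => by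
        rw [Matrix.vecMul_smul, Matrix.vecMul_transpose, smul_dotProduct, dotProduct_smul,
          smul_eq_mul, smul_eq_mul]
        linarith [hlow v])
    rw [norm_smul, Matrix.frobenius_norm_transpose, Real.norm_two] at h1
    have h2 : 2 * (√c * s) * ‖(1 - Ψ * Ψᵀ) * J‖ ≤ 2 * (√c * s) * (2 * f / √c * s ^ 2) := by
      calc _ ≤ 2 * (2 * (f * s ^ 3)) := h1.trans (by gcongr)
        _ = _ := by field_simp
    exact le_of_mul_le_mul_left h2 (by positivity)
  have hsq := frobenius_norm_sq_projection_sub hSVD.2.transpose_mul_self hJ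
  -- The exact factor `√2` is rounded up to `2`.
  have h2 : ‖Ψ * Ψᵀ - J * Jᵀ‖ ≤ 2 * ‖(1 - Ψ * Ψᵀ) * J‖ := by
    apply le_of_sq_le_sq _ (by positivity)
    rw [hsq, mul_pow]
    exact mul_le_mul_of_nonneg_right (by norm_num) (sq_nonneg _)
  calc _ ≤ 2 * (2 * f / √c * s ^ 2) := h2.trans (by gcongr)
    _ = _ := by ring

theorem tangentProjection_eq {n d : ℕ}
    {ι : EuclideanSpace ℝ (Fin d) → EuclideanSpace ℝ (Fin n)}
    (hJ : (jacobian ι)ᵀ * jacobian ι = 1) :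
    tangentProjection ι = jacobian ι * (jacobian ι)ᵀ := by
  rw [tangentProjection, hJ, inv_one, Matrix.mul_one]

/-- The deterministic form of the error bound. -/
theorem exists_frobeniusNorm_projection_sub_le {n d K : ℕ} (hdn : d ≤ n) (hK : 0 < K)
    {ι : EuclideanSpace ℝ (Fin d) → EuclideanSpace ℝ (Fin n)} (hι : ContDiffAt ℝ 3 ι 0)
    (hJ : (jacobian ι)ᵀ * jacobian ι = 1) {c : ℝ} (hc : 0 < c) {h : ℝ → ℝ}
    (hh : Tendsto (fun ε : ℝ => h ε / ε ^ (3 / 2 : ℝ)) (𝓝[>] 0) atTop) :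
    ∃ C > 0, ∃ ε₀ > 0, ∀ ε : ℝ, 0 < ε → ε < ε₀ →
      ∀ ρ : Fin K → EuclideanSpace ℝ (Fin d), (∀ l, ρ l ∈ cube d ε) →
      ∀ T Ψ : Matrix (Fin n) (Fin d) ℝ,
        IsSecondOrderSVD hdn (neighbourDifferences ι ρ) T Ψ →
        SampleConditions ι ρ T (h ε) (c * ε) →
        frobeniusNorm (Ψ * Ψᵀ - tangentProjection ι) ≤ C * ε := by
  rcases hdn.eq_or_lt with rfl | hlt
  -- For `d = n` there is no further eigenvalue to compare with, but both projections are the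
  -- identity.
  · refine ⟨1, one_pos, 1, one_pos, fun ε hε _ ρ _ T Ψ hSVD _ => ?_⟩
    rw [tangentProjection_eq hJ, mul_eq_one_comm.1 hJ,
      mul_eq_one_comm.1 hSVD.2.transpose_mul_self, sub_self, frobeniusNorm_eq_norm, norm_zero]
    positivity
  obtain ⟨C, hC, e, he, r, hr, hmain⟩ := exists_norm_projection_sub_le (K := K) hlt hι hJ hc
  -- The growth of `h` is used at the threshold `e`: for `ε < δ` one has `h ε > e ε^(3/2)`, and `K ≥
  -- 1` carries this over to `K h ε`.
  obtain ⟨δ, hδ, hball⟩ := Metric.mem_nhdsWithin_iff.1 (hh.eventually_gt_atTop e)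
  refine ⟨C + 1, by positivity, min δ (r ^ 2), by positivity, fun ε hε hεlt ρ hρ T Ψ hSVD hcond => ?_⟩
  have hsq : √ε ^ 2 = ε := Real.sq_sqrt hε.le
  have hsr : √ε < r := by
    rw [Real.sqrt_lt' hr]
    exact hεlt.trans_le (min_le_right _ _)
  have hpow : ε ^ (3 / 2 : ℝ) = √ε ^ 3 := by
    rw [Real.sqrt_eq_rpow, ← Real.rpow_mul_natCast hε.le]
    norm_num
  have hhε : e < h ε / ε ^ (3 / 2 : ℝ) := by
    refine hball ⟨?_, hε⟩
    rw [Metric.mem_ball, Real.dist_eq, sub_zero, abs_of_pos hε]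
    exact hεlt.trans_le (min_le_left _ _)
  rw [hpow, lt_div_iff₀ (by positivity)] at hhε
  have hh0 : 0 ≤ h ε := le_trans (by positivity) hhε.le
  have hK1 : (1 : ℝ) ≤ K := by exact_mod_cast hK
  have hmin : e * √ε ^ 3 < minSingularValue (designMatrix (coordMatrix ρ)) := by
    have h1 := hcond.1.trans (spectralNorm_div_conditionNumber_le _)
    nlinarith
  have hbound := hmain √ε (Real.sqrt_pos.2 hε) hsr ρ (fun l j => abs_le.2 (hρ l j)) T Ψ hSVD hmin
    (by rw [hsq]; exact hcond.2)
  rw [hsq] at hbound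
  rw [tangentProjection_eq hJ, frobeniusNorm_eq_norm]
  linarith

end Estimator

/-! ### From uniform sampling to the deterministic bound. -/

theorem measurableSet_cube (d : ℕ) (ε : ℝ) : MeasurableSet (cube d ε) := by
  have h : cube d ε = ⋂ j, (fun v : EuclideanSpace ℝ (Fin d) => v j) ⁻¹'
      Set.Icc (-Real.sqrt ε) (Real.sqrt ε) := by
    ext v
    simp [cube]
  rw [h]
  exact MeasurableSet.iInter fun j => by
    have : Measurable fun v : EuclideanSpace ℝ (Fin d) => v j := by fun_prop
    exact this measurableSet_Icc

theorem ae_mem_cube_of_isUniform {d : ℕ} {ε : ℝ} {Ω : Type*} [MeasurableSpace Ω] {μ : Measure Ω}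
    {X : Ω → EuclideanSpace ℝ (Fin d)} (hX : Measurable X)
    (h : pdf.IsUniform X (cube d ε) μ volume) : ∀ᵐ ω ∂μ, X ω ∈ cube d ε := by
  apply ae_of_ae_map hX.aemeasurable
  rw [show μ.map X = ProbabilityTheory.cond volume (cube d ε) from h]
  exact ae_cond_mem (measurableSet_cube d ε)

end LocalSVD

theorem theorem3p2 {n d K : ℕ} (hdn : d ≤ n) (hK : d * (d + 1) / 2 < K)
    (M : Set (EuclideanSpace ℝ (Fin n))) (hM : LocalSVD.IsEmbeddedManifold d M)
    (x : EuclideanSpace ℝ (Fin n)) (hx : x ∈ M)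
    (ι : EuclideanSpace ℝ (Fin d) → EuclideanSpace ℝ (Fin n))
    (hι : LocalSVD.IsLocalParametrization M x ι)
    (hτ : (LocalSVD.jacobian ι).transpose * LocalSVD.jacobian ι = 1)
    (c : ℝ) (hc : 0 < c) (h : ℝ → ℝ)
    (hh : Tendsto (fun ε : ℝ => h ε / ε ^ (3 / 2 : ℝ)) (𝓝[>] 0) atTop) :
    ∃ C > 0, ∃ ε₀ > 0, ∀ ε : ℝ, 0 < ε → ε < ε₀ →
      ∀ (Ω : Type*) [MeasurableSpace Ω] (μ : Measure Ω) [IsProbabilityMeasure μ]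
        (ρ : Fin K → Ω → EuclideanSpace ℝ (Fin d)),
        (∀ i, Measurable (ρ i)) → iIndepFun ρ μ →
        (∀ i, pdf.IsUniform (ρ i) (LocalSVD.cube d ε) μ volume) →
        ∀ T Ψ : Ω → Matrix (Fin n) (Fin d) ℝ,
          (∀ ω, LocalSVD.IsSecondOrderSVD hdn
            (LocalSVD.neighbourDifferences ι fun i => ρ i ω) (T ω) (Ψ ω)) →
          (∀ᵐ ω ∂μ, LocalSVD.SampleConditions ι (fun i => ρ i ω) (T ω) (h ε) (c * ε) →
            LocalSVD.frobeniusNorm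
              (Ψ ω * (Ψ ω).transpose - LocalSVD.tangentProjection ι) ≤ C * ε) ∧
          ∀ δ : ℝ≥0∞,
            μ {ω | ¬ LocalSVD.SampleConditions ι (fun i => ρ i ω) (T ω) (h ε) (c * ε)} ≤ δ →
            μ {ω | ¬ LocalSVD.frobeniusNorm
              (Ψ ω * (Ψ ω).transpose - LocalSVD.tangentProjection ι) ≤ C * ε} ≤ δ := by
  obtain ⟨-, O, hO, h0, hsmooth, -⟩ := hι
  obtain ⟨C, hC, ε₀, hε₀, hmain⟩ := LocalSVD.exists_frobeniusNorm_projection_sub_le hdn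
    ((Nat.zero_le _).trans_lt hK) (hsmooth.contDiffAt (hO.mem_nhds h0)) hτ hc hh
  refine ⟨C, hC, ε₀, hε₀, fun ε hε hlt Ω _ μ _ ρ hρm _ hρu T Ψ hSVD => ?_⟩
  have hae : ∀ᵐ ω ∂μ, LocalSVD.SampleConditions ι (fun i => ρ i ω) (T ω) (h ε) (c * ε) →
      LocalSVD.frobeniusNorm
        (Ψ ω * (Ψ ω).transpose - LocalSVD.tangentProjection ι) ≤ C * ε := by
    filter_upwards [ae_all_iff.2 fun i => LocalSVD.ae_mem_cube_of_isUniform (hρm i) (hρu i)]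
      with ω hω hcond
    exact hmain ε hε hlt _ hω _ _ (hSVD ω) hcond
  -- Up to a null set the bad event lies in the failure of the conditions. Monotonicity needs no
  -- measurability, so `T` and `Ψ` may be arbitrary choices of singular vectors.
  refine ⟨hae, fun δ hδ => (measure_mono_ae ?_).trans hδ⟩
  filter_upwards [hae] with ω hω hbad hcond
  exact hbad (hω hcond)
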